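/- All graphs are finite and simple (no loops or multiple edges); $v(H)$ denotes the number of vertices of $H$. For graphs $H,T$ with $v(T)\ge 1$ let $t(H,T)=\hom(H,T)/v(T)^{v(H)}$, where $\hom(H,T)$ is the number of graph homomorphisms from $H$ to $T$. The homomorphism density domination exponent of $G$ and $H$ is $$C(G,H)=\min\{c\in\mathbb R : t(G,T)\ge t(H,T)^c\ \text{ for all graphs } T \text{ with } v(T)\ge 1\},$$ when this minimum exists. Let $P_m$ be the path with $m$ edges, and let $\nu^*(H)$ be the fractional matching number of $H$, that is, the maximum of $\sum_{e\in E(H)}w(e)$ over all $w:E(H)\to[0,\infty)$ with $\sum_{e\ni v}w(e)\le 1$ for every vertex $v$. **Theorem.** In each of the following cases the domination exponent exists and has the stated value. 1. Let $H_1$ be a graph with at least one vertex and no isolated vertices, and let $H_2$ be a graph with $v(H_1)\le v(H_2)$ such that every set of $v(H_1)$ vertices of $H_2$ contains at least one copy of $H_1$ as a (not necessarily induced) subgraph. Then $C(H_1,H_2)=\dfrac{v(H_1)}{v(H_2)}$. 2. Let $H$ be a graph with at least one vertex that can be vertex-covered by vertex-disjoint paths of length at least two, i.e. there are pairwise vertex-disjoint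 paths $P_{\ell_1},\dots,P_{\ell_k}$ in $H$, all $\ell_i\ge 2$, with $V(H)=\bigsqcup_{i=1}^k V(P_{\ell_i})$ and $E(H)\supseteq\bigsqcup_{i=1}^k E(P_{\ell_i})$. Then $C(P_2,H)=\dfrac{3}{v(H)}$. 3. Let $H$ be a graph with at least one edge. Then $C(K_2,H)=\dfrac1{\nu^*(H)}$. 4. Let $H_1$ be a graph with at least one edge that is isomorphic to a (not necessarily spanning) subgraph of a graph $H_2$, and suppose $\nu^*(H_1)=\nu^*(H_2)$. Then $C(H_1,H_2)=1$. -/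

import Mathlib

namespace DominationExponent

/-- The homomorphism density `t(H, T) = hom(H, T) / v(T) ^ v(H)`. -/
noncomputable def homDensity {V W : Type*} [Fintype V] [Fintype W]
    (H : SimpleGraph V) (T : SimpleGraph W) : ℝ :=
  (Nat.card (H →g T) : ℝ) / (Fintype.card W : ℝ) ^ Fintype.card V

/-- The set of all real `c` such that `t(G, T) ≥ t(H, T) ^ c` for all finite simple graphs `T`
with at least one vertex. -/
def dominatingExponents {V V' : Type*} [Fintype V] [Fintype V']
    (G : SimpleGraph V) (H : SimpleGraph V') : Set ℝ :=
  {c : ℝ | ∀ (W : Type) [Fintype W] [Nonempty W] (T : SimpleGraph W),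
    homDensity H T ^ c ≤ homDensity G T}

/-- The homomorphism density domination exponent `C(G, H)` exists and is equal to `c`:
`c` is the minimum of the real exponents valid for all target graphs. -/
def HasDominationExponent {V V' : Type*} [Fintype V] [Fintype V']
    (G : SimpleGraph V) (H : SimpleGraph V') (c : ℝ) : Prop :=
  IsLeast (dominatingExponents G H) c

/-- The path `P_m` with `m` edges (and `m + 1` vertices). -/
abbrev path (m : ℕ) : SimpleGraph (Fin (m + 1)) := SimpleGraph.pathGraph (m + 1)

/-- `H` is vertex-covered by vertex-disjoint paths of length at least two: there are paths
`P_{ℓ 0}, …, P_{ℓ (k - 1)}` in `H`, all of length at least two, such that every vertex of `H`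
is a vertex of exactly one of them (and occurs on it exactly once). -/
def IsCoveredByLongPaths {V : Type*} (H : SimpleGraph V) : Prop :=
  ∃ (k : ℕ) (ℓ : Fin k → ℕ) (f : (i : Fin k) → path (ℓ i) →g H),
    (∀ i, 2 ≤ ℓ i) ∧
    Function.Bijective (fun p : (i : Fin k) × Fin (ℓ i + 1) => f p.1 p.2)

open Classical in
/-- A fractional matching: nonnegative weights on the edges such that the total weight of the
edges at each vertex is at most one. (Values of `w` off the edge set are irrelevant.) -/
def IsFractionalMatching {V : Type*} [Fintype V] (H : SimpleGraph V) (w : Sym2 V → ℝ) : Prop :=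
  (∀ e ∈ H.edgeFinset, 0 ≤ w e) ∧ ∀ v : V, ∑ e ∈ H.edgeFinset with v ∈ e, w e ≤ 1

open Classical in
/-- The fractional matching number `ν*(H)`: the largest total weight of a fractional matching. -/
noncomputable def fractionalMatchingNumber {V : Type*} [Fintype V] (H : SimpleGraph V) : ℝ :=
  sSup {s : ℝ | ∃ w : Sym2 V → ℝ, IsFractionalMatching H w ∧ s = ∑ e ∈ H.edgeFinset, w e}

end DominationExponent

/-! ### Hölder and Finner inequalities -/

namespace DominationExponent

open MeasureTheory Function Finset
open scoped ENNReal

/-! Each value needs an upper bound on `t(H, T)` valid for all `T`, and a family of targets showing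
that the exponent cannot be lowered.

The upper bounds come from Finner's inequality: if copies of graphs `G j` in `H` carry weights whose
sum at each vertex is at most one, then `t(H, T) ≤ ∏ t(G j, T) ^ w j` (`homDensity_le_prod_rpow`).
Case 1 spreads equal weight over one copy of `H₁` in each vertex set of size `v(H₁)`; case 3 uses a
fractional matching; the inequality in case 4 is a single copy of weight one. Case 2 gives each
covering path weight one and compares it with `P₂` spectrally: with `d` the degree vector and `A`
the adjacency matrix, `hom(P_{k+2}) = dᵀ Aᵏ d`, while `‖d‖² = hom(P₂)` and `‖A‖³ ≤ hom(P₂)`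
(`abs_eigenvalue_pow_three_le`).

The lower bounds use blow-ups of `H` padded by isolated vertices. In cases 1 and 2, `H` with only
isolated vertices added suffices, because a graph without isolated vertices must map into the
bounded part. In cases 3 and 4, vertex `v` is blown up to about `N ^ (1 - y v)` copies, with `y` a
fractional vertex cover of weight at most `ν*(H)` obtained from LP duality
(`exists_fractional_vertexCover`); then `t(K₂, T)` is of order at most `1/N` but `t(H, T)` of order
at least `N ^ (-ν*(H))`. -/

/-- Generalized Hölder inequality on a probability space, with weights of total at most one. -/
theorem lintegral_prod_rpow_le_of_sum_le_one {X J : Type*} [MeasurableSpace X] (μ : Measure X)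
    [IsProbabilityMeasure μ] (s : Finset J) {f : J → X → ℝ≥0∞} (hf : ∀ j, Measurable (f j))
    {w : J → ℝ} (hw : ∀ j, 0 ≤ w j) (h : ∑ j ∈ s, w j ≤ 1) :
    ∫⁻ x, ∏ j ∈ s, f j x ^ w j ∂μ ≤ ∏ j ∈ s, (∫⁻ x, f j x ∂μ) ^ w j := by
  -- The extra index `none` carries the constant function one with the leftover weight, so that the
  -- weights sum to exactly one.
  have key := ENNReal.lintegral_prod_norm_pow_le (μ := μ) (insertNone s)
    (f := fun o => o.elim (fun _ => 1) f) (p := fun o => o.elim (1 - ∑ j ∈ s, w j) w)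
    (by rintro (_ | j) _ <;> simp [aemeasurable_const, (hf _).aemeasurable])
    (by simp [sum_insertNone])
    (by rintro (_ | j) _ <;> simp [hw, h])
  simpa [prod_insertNone] using key

theorem lmarginal_update_eq_of_forall_update_eq {ι X : Type*} [DecidableEq ι] [MeasurableSpace X]
    (μ : ι → Measure X) (s : Finset ι) (f : (ι → X) → ℝ≥0∞) (i : ι)
    (hf : ∀ x t, f (update x i t) = f x) (x : ι → X) (t : X) :
    lmarginal μ s f (update x i t) = lmarginal μ s f x := by
  by_cases hi : i ∈ s
  · exact lmarginal_update_of_mem μ hi f x t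
  · simp only [lmarginal]
    congr 1
    ext y
    have : updateFinset (update x i t) s y = update (updateFinset x s y) i t := by
      ext k
      by_cases hk : k = i
      · subst hk; simp [updateFinset, hi]
      · simp [updateFinset, hk]
    rw [this, hf]

/-- **Finner's inequality** for iterated integrals. -/
theorem lmarginal_prod_rpow_le {ι X J : Type*} [DecidableEq ι] [MeasurableSpace X] [Fintype J]
    (μ : ι → Measure X) [∀ i, IsProbabilityMeasure (μ i)] {f : J → (ι → X) → ℝ≥0∞}
    (hf : ∀ j, Measurable (f j)) (S : J → Finset ι)
    (hS : ∀ j, ∀ i ∉ S j, ∀ x t, f j (update x i t) = f j x)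
    {w : J → ℝ} (hw : ∀ j, 0 ≤ w j) (h : ∀ i, ∑ j with i ∈ S j, w j ≤ 1) (s : Finset ι)
    (x : ι → X) :
    lmarginal μ s (fun x => ∏ j, f j x ^ w j) x ≤ ∏ j, lmarginal μ s (f j) x ^ w j := by
  have hm : Measurable (fun x => ∏ j, f j x ^ w j) :=
    Finset.measurable_fun_prod _ fun j _ => (hf j).pow_const _
  induction s using Finset.induction generalizing x with
  | empty => simp
  | insert i s hi ih =>
    rw [lmarginal_insert _ hm hi]
    simp_rw [fun j => lmarginal_insert (μ := μ) (f j) (hf j) hi x]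
    have hmeas : ∀ j, Measurable fun t => lmarginal μ s (f j) (update x i t) := fun j =>
      ((hf j).lmarginal μ).comp (measurable_update x)
    calc ∫⁻ t, lmarginal μ s (fun x => ∏ j, f j x ^ w j) (update x i t) ∂μ i
        ≤ ∫⁻ t, ∏ j, lmarginal μ s (f j) (update x i t) ^ w j ∂μ i :=
          lintegral_mono fun t => ih _
      -- Factors that do not see coordinate `i` are constants here. Hölder is needed only for the
      -- others, whose weights sum to at most one by `h i`.
      _ = ∫⁻ t, (∏ j with i ∉ S j, lmarginal μ s (f j) x ^ w j) *
            ∏ j with i ∈ S j, lmarginal μ s (f j) (update x i t) ^ w j ∂μ i := by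
          congr 1
          ext t
          rw [mul_comm, ← prod_filter_mul_prod_filter_not univ (fun j => i ∈ S j)]
          congr 1
          refine prod_congr rfl fun j hj => ?_
          rw [lmarginal_update_eq_of_forall_update_eq μ s (f j) i (hS j i (mem_filter.1 hj).2)]
      _ = (∏ j with i ∉ S j, lmarginal μ s (f j) x ^ w j) *
            ∫⁻ t, ∏ j with i ∈ S j, lmarginal μ s (f j) (update x i t) ^ w j ∂μ i :=
          lintegral_const_mul _
            (Finset.measurable_fun_prod _ fun j _ => (hmeas j).pow_const _)
      _ ≤ (∏ j with i ∉ S j, lmarginal μ s (f j) x ^ w j) *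
            ∏ j with i ∈ S j, (∫⁻ t, lmarginal μ s (f j) (update x i t) ∂μ i) ^ w j := by
          gcongr
          exact lintegral_prod_rpow_le_of_sum_le_one (μ i) _ hmeas hw (h i)
      _ = ∏ j, (∫⁻ t, lmarginal μ s (f j) (update x i t) ∂μ i) ^ w j := by
          rw [mul_comm, ← prod_filter_mul_prod_filter_not univ (fun j => i ∈ S j)]
          congr 1
          refine prod_congr rfl fun j hj => ?_
          simp_rw [lmarginal_update_eq_of_forall_update_eq μ s (f j) i
            (hS j i (mem_filter.1 hj).2)]
          simp

/-- Coordinates outside the range of `e` integrate out to one, the measure being a probability. -/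
theorem lintegral_pi_comp_injective {ι κ X : Type*} [Fintype ι] [Fintype κ] [MeasurableSpace X]
    (μ : Measure X) [IsProbabilityMeasure μ] {e : κ → ι} (he : Injective e)
    {f : (κ → X) → ℝ≥0∞} (hf : Measurable f) :
    ∫⁻ x, f (x ∘ e) ∂Measure.pi (fun _ : ι => μ) = ∫⁻ y, f y ∂Measure.pi (fun _ : κ => μ) := by
  classical
  have hc : Measurable fun x : ι → X => f (x ∘ e) :=
    hf.comp (measurable_pi_iff.mpr fun i => measurable_pi_apply (e i))
  have : Nonempty X := μ.nonempty_of_neZero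
  obtain ⟨x₀⟩ : Nonempty (ι → X) := inferInstance
  have him : lmarginal (fun _ : ι => μ) (univ.image e) (fun x => f (x ∘ e)) =
      fun _ => ∫⁻ y, f y ∂Measure.pi (fun _ : κ => μ) := by
    ext x
    have := lmarginal_image (μ := fun _ : ι => μ) he univ hf x
    rw [lmarginal_univ] at this
    exact this
  rw [lintegral_eq_lmarginal_univ x₀, ← union_compl (univ.image e),
    lmarginal_union' _ _ hc disjoint_compl_right, him]
  simp [lmarginal]

end DominationExponent

/-! ### Packing bounds for homomorphism densities, and the asymptotic test -/

namespace DominationExponent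

open MeasureTheory Function Finset
open scoped ENNReal

theorem homDensity_nonneg {V W : Type*} [Fintype V] [Fintype W]
    (H : SimpleGraph V) (T : SimpleGraph W) : 0 ≤ homDensity H T := by
  unfold homDensity; positivity

/-- The density is the probability that a uniformly random vertex map is a homomorphism; this is how
Finner's inequality applies. -/
theorem pi_uniform_setOf_hom {V W : Type*} [Fintype V] [Fintype W] [Nonempty W]
    [MeasurableSpace W] [MeasurableSingletonClass W]
    (H : SimpleGraph V) (T : SimpleGraph W) :
    Measure.pi (fun _ : V => (PMF.uniformOfFintype W).toMeasure)
      {x | ∀ u v, H.Adj u v → T.Adj (x u) (x v)} = ENNReal.ofReal (homDensity H T) := by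
  classical
  have hcard : Nat.card (H →g T) =
      #{x : V → W | ∀ u v, H.Adj u v → T.Adj (x u) (x v)} := by
    rw [← Fintype.card_subtype, ← Nat.card_eq_fintype_card]
    exact Nat.card_congr
      { toFun := fun f => ⟨f, fun u v h => f.map_adj h⟩
        invFun := fun f => ⟨f.1, fun {u v} h => f.2 u v h⟩
        left_inv := fun f => rfl
        right_inv := fun f => rfl }
  have hW : (0 : ℝ) < Fintype.card W := by exact_mod_cast Fintype.card_pos
  rw [← lintegral_indicator_one (Set.toFinite _).measurableSet, lintegral_fintype]
  simp only [Measure.pi_singleton, PMF.toMeasure_apply_singleton _ _ (measurableSet_singleton _),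
    PMF.uniformOfFintype_apply, prod_const, card_univ, ← sum_mul, Set.indicator_apply,
    Set.mem_ofPred_eq, Pi.one_apply, sum_boole]
  rw [homDensity, hcard, ENNReal.ofReal_div_of_pos (by positivity), ENNReal.ofReal_pow hW.le,
    ENNReal.ofReal_natCast, ENNReal.ofReal_natCast, ENNReal.div_eq_inv_mul, mul_comm,
    ENNReal.inv_pow]

open Classical in
/-- Generalized Hölder inequality for homomorphism densities: a fractional packing of copies of
graphs `G j` in `H` bounds the density of `H`. -/
theorem homDensity_le_prod_rpow {V W J : Type*} {U : J → Type*} [Fintype V] [Fintype W]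
    [Nonempty W] [Fintype J] [∀ j, Fintype (U j)] (H : SimpleGraph V)
    (G : ∀ j, SimpleGraph (U j)) (e : ∀ j, G j →g H) (he : ∀ j, Injective (e j))
    {w : J → ℝ} (hw : ∀ j, 0 ≤ w j)
    (h : ∀ v, ∑ j, (if v ∈ Set.range (e j) then w j else 0) ≤ 1) (T : SimpleGraph W) :
    homDensity H T ≤ ∏ j, homDensity (G j) T ^ w j := by
  let _ : MeasurableSpace W := ⊤
  have : DiscreteMeasurableSpace W := ⟨fun _ => trivial⟩
  set μ := (PMF.uniformOfFintype W).toMeasure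
  let A : ∀ j, Set (U j → W) := fun j => {x | ∀ u v, (G j).Adj u v → T.Adj (x u) (x v)}
  let f : J → (V → W) → ℝ≥0∞ := fun j x => (A j).indicator 1 (x ∘ e j)
  have hf : ∀ j, Measurable (f j) := fun j => measurable_of_finite _
  have hint : ∀ j, ∫⁻ x, f j x ∂Measure.pi (fun _ : V => μ) =
      ENNReal.ofReal (homDensity (G j) T) := fun j => by
    rw [lintegral_pi_comp_injective μ (he j) (f := (A j).indicator 1) (measurable_of_finite _),
      lintegral_indicator_one (Set.toFinite _).measurableSet]
    exact pi_uniform_setOf_hom (G j) T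
  obtain ⟨x₀⟩ : Nonempty (V → W) := inferInstance
  have key := lmarginal_prod_rpow_le (fun _ : V => μ) hf (fun j => univ.image (e j))
    (fun j i hi x t => by
      have : update x i t ∘ e j = x ∘ e j := by
        ext u
        have : e j u ≠ i := fun hu => hi (by simp [← hu])
        simp [this]
      simp only [f, this]) hw
    (fun v => by simpa [sum_filter] using h v) univ x₀
  simp only [lmarginal_univ, hint] at key
  have hle : ENNReal.ofReal (homDensity H T) ≤ ∏ j, ENNReal.ofReal (homDensity (G j) T) ^ w j := by
    refine le_trans ?_ key
    rw [← pi_uniform_setOf_hom, ← lintegral_indicator_one (Set.toFinite _).measurableSet]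
    refine lintegral_mono fun x => ?_
    by_cases hx : x ∈ {x : V → W | ∀ u v, H.Adj u v → T.Adj (x u) (x v)}
    swap
    · simp only [Set.indicator_of_notMem hx, zero_le]
    rw [Set.indicator_of_mem hx]
    have h1 : ∀ j, f j x = 1 := fun j =>
      Set.indicator_of_mem (show x ∘ e j ∈ A j from fun u v huv => hx _ _ ((e j).map_adj huv)) _
    simp [h1]
  simp_rw [fun j => ENNReal.ofReal_rpow_of_nonneg (homDensity_nonneg (G j) T) (hw j)] at hle
  rw [← ENNReal.ofReal_prod_of_nonneg
    fun j _ => Real.rpow_nonneg (homDensity_nonneg (G j) T) _] at hle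
  exact (ENNReal.ofReal_le_ofReal_iff
    (prod_nonneg fun j _ => Real.rpow_nonneg (homDensity_nonneg (G j) T) _)).1 hle

theorem homDensity_le_one {V W : Type*} [Fintype V] [Fintype W] [Nonempty W]
    (H : SimpleGraph V) (T : SimpleGraph W) : homDensity H T ≤ 1 := by
  -- The empty packing: the product on the right is empty.
  simpa using homDensity_le_prod_rpow (J := Empty) (U := fun _ => Empty) H (fun _ => ⊥)
    (fun j => j.elim) (fun j => j.elim) (w := fun _ => 0) (fun j => j.elim) (by simp) T

open Classical in
/-- The case of copies of a single graph. -/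
theorem homDensity_le_rpow_sum {U V W J : Type*} [Fintype U] [Fintype V] [Fintype W]
    [Nonempty W] [Fintype J] {H : SimpleGraph V} {G : SimpleGraph U} (e : J → (G →g H))
    (he : ∀ j, Injective (e j)) {w : J → ℝ} (hw : ∀ j, 0 ≤ w j)
    (h : ∀ v, ∑ j, (if v ∈ Set.range (e j) then w j else 0) ≤ 1) (T : SimpleGraph W) :
    homDensity H T ≤ homDensity G T ^ ∑ j, w j := by
  rw [Real.rpow_sum_of_nonneg (homDensity_nonneg G T) fun j _ => hw j]
  exact homDensity_le_prod_rpow H (fun _ => G) e he hw h T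

theorem homDensity_le_of_isContained {V₁ V₂ W : Type*} [Fintype V₁] [Fintype V₂] [Fintype W]
    [Nonempty W] {H₁ : SimpleGraph V₁} {H₂ : SimpleGraph V₂} (h : H₁.IsContained H₂)
    (T : SimpleGraph W) : homDensity H₂ T ≤ homDensity H₁ T := by
  obtain ⟨φ⟩ := h
  simpa using homDensity_le_rpow_sum (J := Unit) (fun _ => φ.toHom) (fun _ => φ.injective)
    (w := fun _ => 1) (fun _ => zero_le_one) (fun v => by simp; split_ifs <;> simp) T

theorem homDensity_congr_right {V W W' : Type*} [Fintype V] [Fintype W] [Fintype W']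
    (H : SimpleGraph V) {T : SimpleGraph W} {T' : SimpleGraph W'} (φ : T ≃g T') :
    homDensity H T = homDensity H T' := by
  have : Nat.card (H →g T) = Nat.card (H →g T') := Nat.card_congr
    { toFun := fun f => φ.toHom.comp f
      invFun := fun f => φ.symm.toHom.comp f
      left_inv := fun f => by ext; simp
      right_inv := fun f => by ext; simp }
  rw [homDensity, homDensity, this, Fintype.card_congr φ.toEquiv]

/-- Membership in `dominatingExponents` gives the inequality for targets in every universe. -/
theorem rpow_homDensity_le_of_mem {V V' W : Type*} [Fintype V] [Fintype V'] [Fintype W]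
    [Nonempty W] {G : SimpleGraph V} {H : SimpleGraph V'} {c : ℝ}
    (hc : c ∈ dominatingExponents G H) (T : SimpleGraph W) :
    homDensity H T ^ c ≤ homDensity G T := by
  let φ : T ≃g T.map (Fintype.equivFin W).toEmbedding := SimpleGraph.Iso.map (Fintype.equivFin W) T
  have : Nonempty (Fin (Fintype.card W)) := ⟨Fintype.equivFin W (Classical.arbitrary W)⟩
  rw [homDensity_congr_right H φ, homDensity_congr_right G φ]
  exact hc _ _

/-- Asymptotic lower bound for dominating exponents. -/
theorem div_le_of_mem_dominatingExponents {V V' : Type*} [Fintype V] [Fintype V']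
    {G : SimpleGraph V} {H : SimpleGraph V'} {c p q a b : ℝ} (hp : 0 < p) (hq : 0 < q)
    (ha : 0 < a) (W : ℕ → Type*) [∀ N, Fintype (W N)] [∀ N, Nonempty (W N)]
    (T : ∀ N, SimpleGraph (W N))
    (hH : ∀ N : ℕ, a * ((N + 1 : ℕ) : ℝ) ^ (-q) ≤ homDensity H (T N))
    (hG : ∀ N : ℕ, homDensity G (T N) ≤ b * ((N + 1 : ℕ) : ℝ) ^ (-p))
    (hc : c ∈ dominatingExponents G H) : p / q ≤ c := by
  -- A negative `c` is ruled out along the way: densities are at most one, so raising the exponent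
  -- to `max c 0` only weakens the inequality, and `0 < p` then excludes `c ≤ 0`.
  suffices hmax : p ≤ q * max c 0 by
    rcases le_total c 0 with h | h
    · rw [max_eq_right h] at hmax
      linarith
    · rw [max_eq_left h] at hmax
      rw [div_le_iff₀ hq]
      linarith
  by_contra! hlt
  set c' := max c 0
  have hc' : 0 ≤ c' := le_max_right _ _
  have hbound : ∀ N : ℕ, ((N + 1 : ℕ) : ℝ) ^ (p - q * c') ≤ b / a ^ c' := fun N => by
    have hN' : (0 : ℝ) < (N + 1 : ℕ) := by positivity
    have hpos : 0 < homDensity H (T N) := lt_of_lt_of_le (by positivity) (hH N)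
    have h1 : (a * ((N + 1 : ℕ) : ℝ) ^ (-q)) ^ c' ≤ b * ((N + 1 : ℕ) : ℝ) ^ (-p) :=
      calc (a * ((N + 1 : ℕ) : ℝ) ^ (-q)) ^ c' ≤ homDensity H (T N) ^ c' :=
            Real.rpow_le_rpow (by positivity) (hH N) hc'
        _ ≤ homDensity H (T N) ^ c :=
            Real.rpow_le_rpow_of_exponent_ge hpos (homDensity_le_one _ _) (le_max_left _ _)
        _ ≤ homDensity G (T N) := rpow_homDensity_le_of_mem hc _
        _ ≤ _ := hG N
    rw [Real.mul_rpow ha.le (by positivity), ← Real.rpow_mul hN'.le] at h1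
    rw [le_div_iff₀ (by positivity)]
    calc ((N + 1 : ℕ) : ℝ) ^ (p - q * c') * a ^ c' = (a ^ c' * ((N + 1 : ℕ) : ℝ) ^ (-q * c')) * ((N + 1 : ℕ) : ℝ) ^ p := by
          rw [show p - q * c' = -q * c' + p by ring, Real.rpow_add hN']; ring
      _ ≤ (b * ((N + 1 : ℕ) : ℝ) ^ (-p)) * ((N + 1 : ℕ) : ℝ) ^ p := by gcongr
      _ = b := by rw [mul_assoc, ← Real.rpow_add hN']; simp
  have ht := (tendsto_rpow_atTop (sub_pos.2 hlt)).comp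
    ((tendsto_natCast_atTop_atTop (R := ℝ)).comp (Filter.tendsto_add_atTop_nat 1))
  obtain ⟨N, hN⟩ := (ht.eventually_gt_atTop (b / a ^ c')).exists
  exact absurd (hbound N) (not_le.2 hN)

end DominationExponent

/-! ### Path homomorphisms and adjacency eigenvalues -/

namespace DominationExponent

open Function Finset

theorem card_path_hom_eq_sum {W : Type*} [Fintype W] (T : SimpleGraph W) [DecidableRel T.Adj]
    [DecidableEq W] (l : ℕ) :
    (Nat.card (path l →g T) : ℝ) =
      ∑ f : Fin (l + 1) → W, ∏ i : Fin l, T.adjMatrix ℝ (f i.castSucc) (f i.succ) := by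
  have h : Nat.card (path l →g T) =
      #{f : Fin (l + 1) → W | ∀ i : Fin l, T.Adj (f i.castSucc) (f i.succ)} := by
    rw [← Fintype.card_subtype, ← Nat.card_eq_fintype_card]
    refine Nat.card_congr
      { toFun := fun f => ⟨f, fun i => f.map_adj ?_⟩
        invFun := fun f => ⟨f.1, fun {u v} h => ?_⟩
        left_inv := fun f => rfl
        right_inv := fun f => rfl }
    · simp [SimpleGraph.pathGraph_adj]
    · have key : ∀ u v : Fin (l + 1), u.val + 1 = v.val → T.Adj (f.1 u) (f.1 v) := by
        intro u v huv
        have h1 := f.2 ⟨u, by omega⟩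
        have h2 : (⟨u, by omega⟩ : Fin l).succ = v := by ext; simpa using huv
        rw [h2] at h1
        exact h1
      rcases SimpleGraph.pathGraph_adj.1 h with h | h
      · exact key u v h
      · exact (key v u h).symm
  rw [h]
  simp only [SimpleGraph.adjMatrix_apply, prod_boole, mem_univ, forall_true_left, sum_boole]

/-- The weight `g` on the starting vertex makes the induction work: summing out the first vertex
replaces `g` by `g A`. -/
theorem sum_mul_prod_eq_dotProduct_pow {W : Type*} [Fintype W] [DecidableEq W]
    (A : Matrix W W ℝ) (l : ℕ) (g : W → ℝ) :
    ∑ f : Fin (l + 1) → W, g (f 0) * ∏ i : Fin l, A (f i.castSucc) (f i.succ) =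
      dotProduct g ((A ^ l).mulVec 1) := by
  induction l generalizing g with
  | zero =>
    rw [← (Equiv.funUnique (Fin 1) W).symm.sum_comp]
    simp [dotProduct]
  | succ l ih =>
    rw [pow_succ', ← Matrix.mulVec_mulVec, Matrix.dotProduct_mulVec, ← ih,
      ← (Fin.consEquiv fun _ => W).sum_comp, Fintype.sum_prod_type_right]
    refine sum_congr rfl fun f _ => ?_
    simp only [Fin.consEquiv_apply, Fin.cons_zero, Fin.prod_univ_succ, Fin.castSucc_zero,
      Fin.cons_succ, Matrix.vecMul, dotProduct, sum_mul, ← Fin.succ_castSucc, mul_assoc]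

theorem card_path_hom {W : Type*} [Fintype W] (T : SimpleGraph W) [DecidableRel T.Adj]
    [DecidableEq W] (l : ℕ) :
    (Nat.card (path l →g T) : ℝ) = dotProduct 1 ((T.adjMatrix ℝ ^ l).mulVec 1) := by
  rw [card_path_hom_eq_sum, ← sum_mul_prod_eq_dotProduct_pow]
  simp

/-- The number of homomorphisms of a path of length `k + 2` as a quadratic form in the degrees. -/
theorem card_path_hom_add_two {W : Type*} [Fintype W] (T : SimpleGraph W) [DecidableRel T.Adj]
    [DecidableEq W] (k : ℕ) :
    (Nat.card (path (k + 2) →g T) : ℝ) =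
      dotProduct ((T.adjMatrix ℝ).mulVec 1)
        ((T.adjMatrix ℝ ^ k).mulVec ((T.adjMatrix ℝ).mulVec 1)) := by
  rw [card_path_hom, show T.adjMatrix ℝ ^ (k + 2) = T.adjMatrix ℝ * (T.adjMatrix ℝ ^ k *
    T.adjMatrix ℝ) by rw [← pow_succ, ← pow_succ'], ← Matrix.mulVec_mulVec,
    Matrix.dotProduct_mulVec, ← Matrix.mulVec_mulVec, ← Matrix.mulVec_transpose,
    SimpleGraph.transpose_adjMatrix]

/-- A unit eigenvector bound: the cube of an eigenvalue is at most the sum of squared degrees. -/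
theorem abs_eigenvalue_pow_three_le {W : Type*} [Fintype W] (T : SimpleGraph W)
    [DecidableRel T.Adj] [DecidableEq W] {x : W → ℝ} {r : ℝ} (hx : ∑ u, x u ^ 2 = 1)
    (hr : (T.adjMatrix ℝ).mulVec x = r • x) :
    |r| ^ 3 ≤ ∑ u, (T.degree u : ℝ) ^ 2 := by
  have hu : ∀ u, ∑ v, T.adjMatrix ℝ u v * x v = r * x u := fun u => congrFun hr u
  have hdeg : ∀ u, ∑ v, T.adjMatrix ℝ u v = (T.degree u : ℝ) := fun u => by
    simp [SimpleGraph.adjMatrix_apply, ← T.card_neighborFinset_eq_degree,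
      T.neighborFinset_eq_filter]
  have hA : ∀ u v, T.adjMatrix ℝ u v ^ 2 = T.adjMatrix ℝ u v := fun u v => by
    simp [SimpleGraph.adjMatrix_apply]
  have hA0 : ∀ u v, 0 ≤ T.adjMatrix ℝ u v := fun u v => by rw [← hA]; positivity
  -- Cauchy–Schwarz on row `u`, whose entries are 0 or 1. The next bound is AM–GM on the quadratic
  -- form; multiplying it by `r ^ 2` and inserting this one gives the cube.
  have h1 : ∀ u, r ^ 2 * x u ^ 2 ≤ T.degree u := fun u => by
    rw [← mul_pow, ← hu]
    refine (sum_mul_sq_le_sq_mul_sq _ _ _).trans ?_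
    rw [hx, mul_one]
    simp_rw [hA, hdeg]
    rfl
  have h2 : |r| ≤ ∑ u, T.degree u * x u ^ 2 := by
    have hr2 : r = ∑ u, ∑ v, T.adjMatrix ℝ u v * (x u * x v) := by
      calc r = r * ∑ u, x u ^ 2 := by rw [hx, mul_one]
        _ = ∑ u, x u * (r * x u) := by
            rw [mul_sum]
            exact sum_congr rfl fun u _ => by ring
        _ = _ := sum_congr rfl fun u _ => by
            rw [← hu, mul_sum]
            exact sum_congr rfl fun v _ => by ring
    calc |r| ≤ ∑ u, ∑ v, T.adjMatrix ℝ u v * ((x u ^ 2 + x v ^ 2) / 2) := by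
          conv_lhs => rw [hr2]
          refine (abs_sum_le_sum_abs _ _).trans (sum_le_sum fun u _ => ?_)
          refine (abs_sum_le_sum_abs _ _).trans (sum_le_sum fun v _ => ?_)
          rw [abs_mul, abs_of_nonneg (hA0 u v)]
          refine mul_le_mul_of_nonneg_left (abs_le.2 ⟨?_, ?_⟩) (hA0 u v)
          · nlinarith [sq_nonneg (x u + x v)]
          · nlinarith [sq_nonneg (x u - x v)]
      _ = (∑ u, ∑ v, T.adjMatrix ℝ u v * x u ^ 2) / 2 +
          (∑ u, ∑ v, T.adjMatrix ℝ u v * x v ^ 2) / 2 := by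
          simp_rw [sum_div, ← sum_add_distrib]
          exact sum_congr rfl fun u _ => sum_congr rfl fun v _ => by ring
      _ = ∑ u, T.degree u * x u ^ 2 := by
          rw [sum_comm (f := fun u v => T.adjMatrix ℝ u v * x v ^ 2)]
          have : ∀ u v, T.adjMatrix ℝ u v = T.adjMatrix ℝ v u := fun u v => by
            simp [SimpleGraph.adjMatrix_apply, T.adj_comm]
          simp_rw [fun u v => this v u, ← sum_mul, hdeg]
          ring
  calc |r| ^ 3 = r ^ 2 * |r| := by rw [← sq_abs]; ring
    _ ≤ r ^ 2 * ∑ u, T.degree u * x u ^ 2 := by gcongr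
    _ = ∑ u, T.degree u * (r ^ 2 * x u ^ 2) := by
        rw [mul_sum]
        exact sum_congr rfl fun u _ => by ring
    _ ≤ ∑ u, (T.degree u : ℝ) ^ 2 := sum_le_sum fun u _ => by
        rw [sq (T.degree u : ℝ)]
        exact mul_le_mul_of_nonneg_left (h1 u) (by positivity)

/-- A symmetric operator whose eigenvalues are bounded by `M` on unit eigenvectors has norm
at most `M`. -/
theorem norm_apply_le_of_eigenvalues_le {E : Type*} [NormedAddCommGroup E] [InnerProductSpace ℝ E]
    [FiniteDimensional ℝ E] {A : E →ₗ[ℝ] E} (hA : A.IsSymmetric) {M : ℝ} (hM : 0 ≤ M)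
    (h : ∀ (x : E) (r : ℝ), ‖x‖ = 1 → A x = r • x → |r| ≤ M) (y : E) : ‖A y‖ ≤ M * ‖y‖ := by
  set b := hA.eigenvectorBasis rfl
  rw [← b.repr.norm_map (A y), ← b.repr.norm_map y]
  refine (sq_le_sq₀ (norm_nonneg _) (by positivity)).1 ?_
  rw [mul_pow, EuclideanSpace.real_norm_sq_eq, EuclideanSpace.real_norm_sq_eq, mul_sum]
  refine sum_le_sum fun i _ => ?_
  rw [hA.eigenvectorBasis_apply_self_apply rfl, mul_pow]
  refine mul_le_mul_of_nonneg_right ?_ (sq_nonneg _)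
  exact sq_le_sq' (neg_le_of_abs_le (h _ _ (b.norm_eq_one i) (hA.apply_eigenvectorBasis rfl i)))
    (le_of_abs_le (h _ _ (b.norm_eq_one i) (hA.apply_eigenvectorBasis rfl i)))

end DominationExponent

/-! ### Comparing long paths with the path of length two -/

namespace DominationExponent

open Function Finset

theorem norm_toLp_adjMatrix_pow_mulVec_le {W : Type*} [Fintype W] (T : SimpleGraph W)
    [DecidableRel T.Adj] [DecidableEq W] {M : ℝ} (hM : 0 ≤ M)
    (h : ∑ u, (T.degree u : ℝ) ^ 2 ≤ M ^ 3) (k : ℕ) (y : W → ℝ) :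
    ‖WithLp.toLp 2 ((T.adjMatrix ℝ ^ k).mulVec y)‖ ≤ M ^ k * ‖WithLp.toLp 2 y‖ := by
  have hsymm : (Matrix.toEuclideanLin (T.adjMatrix ℝ)).IsSymmetric :=
    Matrix.isSymmetric_toEuclideanLin_iff.2 (T.isHermitian_adjMatrix ℝ)
  have hone : ∀ y : W → ℝ, ‖WithLp.toLp 2 ((T.adjMatrix ℝ).mulVec y)‖ ≤
      M * ‖WithLp.toLp 2 y‖ := fun y => by
    refine norm_apply_le_of_eigenvalues_le hsymm hM (fun x r hx hr => ?_) (WithLp.toLp 2 y)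
    refine (pow_le_pow_iff_left₀ (abs_nonneg r) hM three_ne_zero).1 (le_trans ?_ h)
    refine abs_eigenvalue_pow_three_le T (x := x.ofLp) ?_ ?_
    · rw [← EuclideanSpace.real_norm_sq_eq, hx, one_pow]
    · exact congrArg WithLp.ofLp hr
  induction k with
  | zero => simp
  | succ k ih =>
    rw [pow_succ', ← Matrix.mulVec_mulVec, pow_succ', mul_assoc]
    exact (hone _).trans (by gcongr)

/-- Cauchy–Schwarz bounds `dᵀ Aᵏ d` by `‖A‖ᵏ ‖d‖²`, that is by `D ^ (k / 3) * D`. -/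
theorem card_path_hom_le {W : Type*} [Fintype W] (T : SimpleGraph W) (k : ℕ) :
    (Nat.card (path (k + 2) →g T) : ℝ) ≤
      (Nat.card (path 2 →g T) : ℝ) ^ (((k : ℝ) + 3) / 3) := by
  classical
  set d := (T.adjMatrix ℝ).mulVec 1 with hd
  have hdeg : ∀ u, d u = T.degree u := fun u => by
    simp [hd, ← T.card_neighborFinset_eq_degree, T.neighborFinset_eq_filter]
  set D : ℝ := (Nat.card (path 2 →g T) : ℝ) with hD
  have hD0 : 0 ≤ D := Nat.cast_nonneg _
  have hDd : D = ∑ u, (T.degree u : ℝ) ^ 2 := by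
    rw [hD, card_path_hom_add_two T 0]
    simp only [pow_zero, Matrix.one_mulVec, ← hd, dotProduct, hdeg, sq]
  have hnorm : ‖WithLp.toLp 2 d‖ ^ 2 = D := by
    rw [EuclideanSpace.real_norm_sq_eq, hDd]
    simp [hdeg]
  have hM : ∑ u, (T.degree u : ℝ) ^ 2 ≤ (D ^ (1 / 3 : ℝ)) ^ 3 := by
    rw [← Real.rpow_natCast, ← Real.rpow_mul hD0, ← hDd]
    norm_num
  rw [card_path_hom_add_two, ← hd]
  calc dotProduct d ((T.adjMatrix ℝ ^ k).mulVec d)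
      = inner ℝ (WithLp.toLp 2 d) (WithLp.toLp 2 ((T.adjMatrix ℝ ^ k).mulVec d)) := by
        simp [EuclideanSpace.inner_eq_star_dotProduct, dotProduct_comm]
    _ ≤ ‖WithLp.toLp 2 d‖ * ‖WithLp.toLp 2 ((T.adjMatrix ℝ ^ k).mulVec d)‖ :=
        real_inner_le_norm _ _
    _ ≤ ‖WithLp.toLp 2 d‖ * ((D ^ (1 / 3 : ℝ)) ^ k * ‖WithLp.toLp 2 d‖) := by
        gcongr
        exact norm_toLp_adjMatrix_pow_mulVec_le T (by positivity) hM k d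
    _ = (D ^ (1 / 3 : ℝ)) ^ k * D := by rw [← hnorm]; ring
    _ = D ^ (((k : ℝ) + 3) / 3) := by
        rw [← Real.rpow_natCast, ← Real.rpow_mul hD0,
          show ((k : ℝ) + 3) / 3 = 1 / 3 * k + 1 by ring, Real.rpow_add_of_nonneg hD0
            (by positivity) zero_le_one, Real.rpow_one]

theorem homDensity_path_le {W : Type*} [Fintype W] (T : SimpleGraph W) {l : ℕ} (hl : 2 ≤ l) :
    homDensity (path l) T ≤ homDensity (path 2) T ^ (((l : ℝ) + 1) / 3) := by
  obtain ⟨k, rfl⟩ := Nat.exists_eq_add_of_le' hl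
  have h := card_path_hom_le T k
  have hk : (((k + 2 : ℕ) : ℝ) + 1) / 3 = ((k : ℝ) + 3) / 3 := by push_cast; ring
  rw [hk]
  unfold homDensity
  rw [Real.div_rpow (Nat.cast_nonneg _) (by positivity), ← Real.rpow_natCast,
    ← Real.rpow_natCast, ← Real.rpow_mul (Nat.cast_nonneg _)]
  simp only [Fintype.card_fin]
  -- The powers of `v(T)` on the two sides agree, so the count inequality passes to densities
  -- without loss.
  rw [show (((2 + 1 : ℕ) : ℝ) * (((k : ℝ) + 3) / 3)) = ((k + 2 + 1 : ℕ) : ℝ) by push_cast; ring]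
  gcongr

theorem homDensity_le_of_isCoveredByLongPaths {V W : Type*} [Fintype V] [Fintype W] [Nonempty W]
    {H : SimpleGraph V} (hH : IsCoveredByLongPaths H) (T : SimpleGraph W) :
    homDensity H T ≤ homDensity (path 2) T ^ ((Fintype.card V : ℝ) / 3) := by
  classical
  obtain ⟨k, l, f, hl, hf⟩ := hH
  have hcard : (Fintype.card V : ℝ) = ∑ i, ((l i : ℝ) + 1) := by
    rw [← Fintype.card_congr (Equiv.ofBijective _ hf)]
    simp
  have h := homDensity_le_prod_rpow H (fun i => path (l i)) f
    (fun i a b hab => by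
      have := hf.1 (a₁ := ⟨i, a⟩) (a₂ := ⟨i, b⟩) hab
      simpa using this)
    (w := fun _ => 1) (fun _ => zero_le_one)
    (fun v => by
      rw [sum_boole]
      norm_cast
      refine card_le_one.2 fun i hi j hj => ?_
      obtain ⟨a, ha⟩ := (mem_filter.1 hi).2
      obtain ⟨b, hb⟩ := (mem_filter.1 hj).2
      exact congrArg Sigma.fst (hf.1 (a₁ := ⟨i, a⟩) (a₂ := ⟨j, b⟩) (ha.trans hb.symm))) T
  refine h.trans ?_
  rw [hcard, sum_div, Real.rpow_sum_of_nonneg (homDensity_nonneg _ _) fun i _ => by positivity]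
  simp only [Real.rpow_one]
  exact prod_le_prod (fun i _ => homDensity_nonneg _ _) fun i _ => homDensity_path_le T (hl i)

end DominationExponent

/-! ### Fractional matchings and vertex covers -/

namespace DominationExponent

open Function Finset

open Classical in
theorem IsFractionalMatching.sum_le_card {V : Type*} [Fintype V] {H : SimpleGraph V}
    {w : Sym2 V → ℝ} (hw : IsFractionalMatching H w) :
    ∑ e ∈ H.edgeFinset, w e ≤ Fintype.card V := by
  calc ∑ e ∈ H.edgeFinset, w e ≤ ∑ e ∈ H.edgeFinset, ∑ v : V, if v ∈ e then w e else 0 := by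
        refine sum_le_sum fun e he => ?_
        have h0 : ∀ v ∈ univ, 0 ≤ if v ∈ e then w e else 0 := fun v _ => by
          split_ifs
          exacts [hw.1 e he, le_rfl]
        have := single_le_sum h0 (mem_univ e.out.1)
        rwa [if_pos e.out_fst_mem] at this
    _ = ∑ v : V, ∑ e ∈ H.edgeFinset with v ∈ e, w e := by
        rw [sum_comm]
        simp_rw [sum_filter]
    _ ≤ ∑ _v : V, 1 := sum_le_sum fun v _ => hw.2 v
    _ = Fintype.card V := by simp

open Classical in
theorem IsFractionalMatching.sum_le_fractionalMatchingNumber {V : Type*} [Fintype V]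
    {H : SimpleGraph V} {w : Sym2 V → ℝ} (hw : IsFractionalMatching H w) :
    ∑ e ∈ H.edgeFinset, w e ≤ fractionalMatchingNumber H :=
  le_csSup ⟨Fintype.card V, by rintro _ ⟨w, hw, rfl⟩; exact hw.sum_le_card⟩ ⟨w, hw, rfl⟩

theorem one_le_fractionalMatchingNumber {V : Type*} [Fintype V] {H : SimpleGraph V}
    (h : ∃ u v, H.Adj u v) : 1 ≤ fractionalMatchingNumber H := by
  classical
  obtain ⟨u, v, huv⟩ := h
  have hw : IsFractionalMatching H (fun e => if e = s(u, v) then 1 else 0) := by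
    refine ⟨fun e _ => by dsimp only; split_ifs <;> norm_num, fun x => ?_⟩
    rw [sum_ite_eq']
    split_ifs <;> norm_num
  refine le_trans (le_of_eq ?_) hw.sum_le_fractionalMatchingNumber
  rw [sum_ite_eq', if_pos (by simpa using huv)]

/-- Linear programming duality: there is a fractional vertex cover with values in `[0, 1]` of
total weight at most `ν*(H)`. -/
theorem exists_fractional_vertexCover {V : Type*} [Fintype V] (H : SimpleGraph V)
    (h : ∃ u v, H.Adj u v) :
    ∃ y : V → ℝ, (∀ v, 0 ≤ y v) ∧ (∀ v, y v ≤ 1) ∧ (∀ u v, H.Adj u v → 1 ≤ y u + y v) ∧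
      ∑ v, y v ≤ fractionalMatchingNumber H := by
  classical
  set ν := fractionalMatchingNumber H with hν
  have hν0 : 0 < ν := one_pos.trans_le (one_le_fractionalMatchingNumber h)
  -- `C` holds the vertex loads of edge weightings of total one. A load below `1 / ν` everywhere
  -- could be scaled by some `t > ν` to a fractional matching exceeding `ν`, so `C` misses the open
  -- orthant `O`. A separating functional, divided by its threshold `r`, is the cover.
  let C : Set (V → ℝ) := {z | ∃ w : Sym2 V → ℝ, (∀ e ∈ H.edgeFinset, 0 ≤ w e) ∧
    ∑ e ∈ H.edgeFinset, w e = 1 ∧ ∀ v, z v = ∑ e ∈ H.edgeFinset with v ∈ e, w e}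
  let O : Set (V → ℝ) := Set.univ.pi fun _ => Set.Iio (1 / ν)
  have hC : Convex ℝ C := by
    rintro z₁ ⟨w₁, h₁, hs₁, hz₁⟩ z₂ ⟨w₂, h₂, hs₂, hz₂⟩ a b ha hb hab
    refine ⟨fun e => a * w₁ e + b * w₂ e, fun e he => ?_, ?_, fun v => ?_⟩
    · have := h₁ e he
      have := h₂ e he
      positivity
    · rw [sum_add_distrib, ← mul_sum, ← mul_sum, hs₁, hs₂, mul_one, mul_one, hab]
    · rw [sum_add_distrib, ← mul_sum, ← mul_sum, ← hz₁, ← hz₂]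
      rfl
  have hdisj : Disjoint O C := by
    rw [Set.disjoint_left]
    rintro z hzO ⟨w, hw0, hw1, hwz⟩
    have hev : ∀ᶠ t in nhdsWithin ν (Set.Ioi ν), ∀ v, t * z v < 1 := by
      refine Filter.eventually_all.2 fun v => nhdsWithin_le_nhds ?_
      have hlt : ν * z v < 1 := by
        have : z v < 1 / ν := hzO v (Set.mem_univ v)
        rwa [lt_div_iff₀ hν0, mul_comm] at this
      exact (continuous_id.mul continuous_const).continuousAt.eventually_lt
        continuousAt_const hlt
    obtain ⟨t, ht, htν⟩ := (hev.and self_mem_nhdsWithin).exists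
    have htν' : ν < t := htν
    have hm : IsFractionalMatching H (fun e => t * w e) :=
      ⟨fun e he => mul_nonneg (hν0.trans htν').le (hw0 e he), fun v => by
        rw [← mul_sum, ← hwz]
        exact (ht v).le⟩
    have := hm.sum_le_fractionalMatchingNumber
    rw [← mul_sum, hw1, mul_one] at this
    exact absurd htν' (not_lt.2 this)
  obtain ⟨f, r, hfO, hfC⟩ := geometric_hahn_banach_open
    (convex_pi fun _ _ => convex_Iio _) (isOpen_set_pi Set.finite_univ fun _ _ => isOpen_Iio)
    hC hdisj
  set y : V → ℝ := fun v => f (Pi.single v 1) with hy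
  have hf : ∀ z : V → ℝ, f z = ∑ v, z v * y v := fun z => by
    conv_lhs => rw [← Finset.univ_sum_single z]
    rw [map_sum]
    refine sum_congr rfl fun v _ => ?_
    rw [← smul_eq_mul, hy, ← map_smul, ← Pi.single_smul, smul_eq_mul, mul_one]
  have hr : 0 < r := by
    have := hfO 0 fun v _ => by simpa using hν0
    simpa using this
  have hy0 : ∀ v, 0 ≤ y v := fun v => by
    by_contra! hneg
    -- A negative coefficient would give a point of `O` where `f` equals `r`, although `f < r` on
    -- `O`.
    have := hfO (Pi.single v (r / y v)) fun u _ => by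
      have : r / y v ≤ 0 := div_nonpos_of_nonneg_of_nonpos hr.le hneg.le
      refine lt_of_le_of_lt ?_ (one_div_pos.2 hν0)
      by_cases huv : u = v
      · subst huv; simpa using this
      · simp [huv]
    rw [hf] at this
    simp [Pi.single_apply, div_mul_cancel₀ r hneg.ne] at this
  have hsum : ∑ v, y v ≤ ν * r := by
    by_contra! hlt
    have hY : 0 < ∑ v, y v := lt_trans (by positivity) hlt
    have := hfO (fun _ => r / ∑ v, y v) fun u _ => by
      simp only [Set.mem_Iio]
      rw [div_lt_div_iff₀ hY hν0]
      linarith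
    rw [hf, ← mul_sum, div_mul_cancel₀ r hY.ne'] at this
    exact lt_irrefl _ this
  have hedge : ∀ u v, H.Adj u v → r ≤ y u + y v := fun u v huv => by
    have hmem : (fun x => if x = u ∨ x = v then (1 : ℝ) else 0) ∈ C := by
      refine ⟨fun e => if e = s(u, v) then 1 else 0, fun e _ => ?_, ?_, fun x => ?_⟩
      · dsimp only
        split_ifs <;> norm_num
      · rw [sum_ite_eq', if_pos (by simpa using huv)]
      · rw [sum_ite_eq']
        simp [huv]
    have := hfC _ hmem
    rw [hf] at this
    refine this.trans (le_of_eq ?_)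
    have hsplit : ∀ x, (if x = u ∨ x = v then (1 : ℝ) else 0) =
        (if x = u then 1 else 0) + if x = v then 1 else 0 := fun x => by
      by_cases hxu : x = u
      · subst hxu
        simp [huv.ne]
      · simp [hxu]
    simp [hsplit, add_mul, sum_add_distrib]
  -- Truncation at one keeps the cover condition, the other endpoint being nonnegative.
  refine ⟨fun v => min 1 (y v / r), fun v => ?_, fun v => min_le_left _ _, fun u v huv => ?_, ?_⟩
  · exact le_min zero_le_one (div_nonneg (hy0 v) hr.le)
  · have h1 : 1 ≤ y u / r + y v / r := by
      rw [← add_div, one_le_div hr]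
      exact hedge u v huv
    have hu : 0 ≤ y u / r := div_nonneg (hy0 u) hr.le
    have hv : 0 ≤ y v / r := div_nonneg (hy0 v) hr.le
    dsimp only
    rcases min_choice 1 (y u / r) with h | h <;> rcases min_choice 1 (y v / r) with h' | h' <;>
      rw [h, h'] <;> linarith
  · calc ∑ v, min 1 (y v / r) ≤ ∑ v, y v / r := sum_le_sum fun v _ => min_le_right _ _
      _ = (∑ v, y v) / r := by rw [sum_div]
      _ ≤ ν := by rwa [div_le_iff₀ hr]

end DominationExponent

/-! ### Padded blow-ups and lower bounds on exponents -/

namespace DominationExponent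

open Function Finset

/-- The blow-up of `H` in which the vertex `v` has `s v` copies, padded by isolated vertices to
`N` copies of every vertex. -/
def paddedBlowup {V : Type*} (H : SimpleGraph V) (s : V → ℕ) (N : ℕ) :
    SimpleGraph (V × Fin N) where
  Adj x y := H.Adj x.1 y.1 ∧ x.2.val < s x.1 ∧ y.2.val < s y.1
  symm := ⟨fun _ _ h => ⟨h.1.symm, h.2.2, h.2.1⟩⟩
  loopless := ⟨fun _ h => h.1.ne rfl⟩

theorem prod_le_card_hom_paddedBlowup {V : Type*} [Fintype V] (H : SimpleGraph V) {s : V → ℕ}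
    {N : ℕ} (hs : ∀ v, s v ≤ N) : ∏ v, s v ≤ Nat.card (H →g paddedBlowup H s N) := by
  classical
  let F : (∀ v, Fin (s v)) → (H →g paddedBlowup H s N) := fun c =>
    { toFun := fun v => (v, Fin.castLE (hs v) (c v))
      map_rel' := fun {u v} h => ⟨h, (c u).2, (c v).2⟩ }
  have hF : Injective F := fun c c' h => by
    funext v
    have := congrArg (fun f : H →g paddedBlowup H s N => (f v).2) h
    exact Fin.castLE_injective (hs v) this
  have : Finite (H →g paddedBlowup H s N) := Finite.of_injective (fun f v => f v)
    DFunLike.coe_injective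
  simpa using Nat.card_le_card_of_injective F hF

/-- A graph without isolated vertices maps into the non-isolated part of the blow-up. -/
theorem card_hom_paddedBlowup_one_le {U V : Type*} [Fintype U] [Fintype V] {G : SimpleGraph U}
    (hG : ∀ u, ∃ v, G.Adj u v) (H : SimpleGraph V) (N : ℕ) :
    Nat.card (G →g paddedBlowup H (fun _ => 1) N) ≤ Fintype.card V ^ Fintype.card U := by
  have hF : Injective fun (f : G →g paddedBlowup H (fun _ => 1) N) (u : U) => (f u).1 := by
    intro f f' h
    ext u : 1
    have h1 : ∀ f : G →g paddedBlowup H (fun _ => 1) N, (f u).2.val < 1 := fun f => by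
      obtain ⟨v, hv⟩ := hG u
      exact (f.map_adj hv).2.1
    refine Prod.ext (congrFun h u) (Fin.ext ?_)
    have := h1 f
    have := h1 f'
    omega
  classical
  simpa using Nat.card_le_card_of_injective _ hF

theorem card_edge_hom_paddedBlowup_le {V : Type*} [Fintype V] (H : SimpleGraph V) {s : V → ℕ}
    {N : ℕ} {B : ℝ} (hB : ∀ u v, H.Adj u v → (s u : ℝ) * s v ≤ B) (hB0 : 0 ≤ B) :
    (Nat.card (SimpleGraph.completeGraph (Fin 2) →g paddedBlowup H s N) : ℝ) ≤
      Fintype.card V ^ 2 * B := by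
  classical
  let P : Finset (V × V) := univ.filter fun p => H.Adj p.1 p.2
  have h01 : (SimpleGraph.completeGraph (Fin 2)).Adj 0 1 := by simp
  let F : (SimpleGraph.completeGraph (Fin 2) →g paddedBlowup H s N) →
      Σ p : P, Fin (s p.1.1) × Fin (s p.1.2) := fun f =>
    ⟨⟨((f 0).1, (f 1).1), by simpa [P] using (f.map_adj h01).1⟩,
      ⟨(f 0).2, (f.map_adj h01).2.1⟩, ⟨(f 1).2, (f.map_adj h01).2.2⟩⟩
  have hF : Injective F := fun f f' h => by
    have h0 : (f 0).1 = (f' 0).1 := congrArg (fun q => q.1.1.1) h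
    have h1 : (f 1).1 = (f' 1).1 := congrArg (fun q => q.1.1.2) h
    have h2 : (f 0).2.val = (f' 0).2.val := congrArg (fun q => q.2.1.val) h
    have h3 : (f 1).2.val = (f' 1).2.val := congrArg (fun q => q.2.2.val) h
    ext i : 1
    fin_cases i
    · exact Prod.ext h0 (Fin.ext h2)
    · exact Prod.ext h1 (Fin.ext h3)
  have hle := Nat.card_le_card_of_injective F hF
  calc (Nat.card (SimpleGraph.completeGraph (Fin 2) →g paddedBlowup H s N) : ℝ)
      ≤ ∑ p : P, (s p.1.1 : ℝ) * s p.1.2 := by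
        rw [Nat.card_sigma] at hle
        simp only [Nat.card_prod, Nat.card_fin] at hle
        exact_mod_cast hle
    _ ≤ ∑ p : P, B := sum_le_sum fun p _ => hB _ _ (mem_filter.1 p.2).2
    _ = #P * B := by simp
    _ ≤ Fintype.card V ^ 2 * B := by
        gcongr
        have : #P ≤ Fintype.card (V × V) := card_le_univ P
        rw [Fintype.card_prod, ← sq] at this
        exact_mod_cast this

theorem homDensity_paddedBlowup_one_le {U V : Type*} [Fintype U] [Fintype V] [Nonempty V]
    {G : SimpleGraph U} (hG : ∀ u, ∃ v, G.Adj u v) (H : SimpleGraph V) {N : ℕ} (hN : 1 ≤ N) :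
    homDensity G (paddedBlowup H (fun _ => 1) N) ≤ (N : ℝ) ^ (-(Fintype.card U : ℝ)) := by
  have hN' : (0 : ℝ) < N := by exact_mod_cast hN
  have hV : (0 : ℝ) < Fintype.card V := by exact_mod_cast Fintype.card_pos
  have h : (Nat.card (G →g paddedBlowup H (fun _ => 1) N) : ℝ) ≤
      (Fintype.card V : ℝ) ^ Fintype.card U := by
    exact_mod_cast card_hom_paddedBlowup_one_le hG H N
  rw [homDensity, Fintype.card_prod, Fintype.card_fin, Nat.cast_mul, mul_pow, Real.rpow_neg hN'.le,
    Real.rpow_natCast, div_le_iff₀ (by positivity)]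
  refine h.trans (le_of_eq ?_)
  field_simp

/-- Sending each vertex to any of its own copies already gives `∏ s v ≥ N ^ (v(H) - ∑ y v)`
homomorphisms. -/
theorem le_homDensity_paddedBlowup {V : Type*} [Fintype V] [Nonempty V] (H : SimpleGraph V)
    {s : V → ℕ} {N : ℕ} (hN : 1 ≤ N) (hs : ∀ v, s v ≤ N) {y : V → ℝ}
    (hy : ∀ v, (N : ℝ) ^ (1 - y v) ≤ s v) {q : ℝ} (hq : ∑ v, y v ≤ q) :
    ((Fintype.card V : ℝ) ^ Fintype.card V)⁻¹ * (N : ℝ) ^ (-q) ≤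
      homDensity H (paddedBlowup H s N) := by
  have hN' : (0 : ℝ) < N := by exact_mod_cast hN
  have hV : (0 : ℝ) < Fintype.card V := by exact_mod_cast Fintype.card_pos
  have h : (N : ℝ) ^ ((Fintype.card V : ℝ) - q) ≤ Nat.card (H →g paddedBlowup H s N) :=
    calc (N : ℝ) ^ ((Fintype.card V : ℝ) - q) ≤ (N : ℝ) ^ ∑ v, (1 - y v) := by
          refine Real.rpow_le_rpow_of_exponent_le (by exact_mod_cast hN) ?_
          rw [sum_sub_distrib, sum_const, card_univ, nsmul_one]
          linarith
      _ = ∏ v, (N : ℝ) ^ (1 - y v) := Real.rpow_sum_of_pos hN' _ _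
      _ ≤ ∏ v, (s v : ℝ) := prod_le_prod (fun v _ => by positivity) fun v _ => hy v
      _ ≤ _ := by exact_mod_cast prod_le_card_hom_paddedBlowup H hs
  rw [homDensity, Fintype.card_prod, Fintype.card_fin, Nat.cast_mul, mul_pow,
    le_div_iff₀ (by positivity)]
  refine le_trans (le_of_eq ?_) h
  rw [sub_eq_neg_add, Real.rpow_add hN', Real.rpow_natCast]
  field_simp

theorem div_card_le_of_mem_dominatingExponents {U V : Type*} [Fintype U] [Fintype V] [Nonempty U]
    [Nonempty V] {G : SimpleGraph U} (hG : ∀ u, ∃ v, G.Adj u v) {H : SimpleGraph V} {c : ℝ}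
    (hc : c ∈ dominatingExponents G H) :
    (Fintype.card U : ℝ) / Fintype.card V ≤ c := by
  have hU : (0 : ℝ) < Fintype.card U := by exact_mod_cast Fintype.card_pos
  have hV : (0 : ℝ) < Fintype.card V := by exact_mod_cast Fintype.card_pos
  refine div_le_of_mem_dominatingExponents (b := 1) hU hV
    (a := ((Fintype.card V : ℝ) ^ Fintype.card V)⁻¹) (by positivity)
    (fun N => V × Fin (N + 1)) (fun N => paddedBlowup H (fun _ => 1) (N + 1))
    (fun N => ?_) (fun N => ?_) hc
  · exact le_homDensity_paddedBlowup H N.succ_pos (fun _ => N.succ_pos) (y := fun _ => 1)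
      (by simp) (by simp)
  · rw [one_mul]
    exact homDensity_paddedBlowup_one_le hG H N.succ_pos

/-- A sequence of sparse targets in which `H` is as frequent as the fractional matching number
permits. -/
theorem exists_sparse_targets {V : Type*} [Fintype V] (H : SimpleGraph V)
    (h : ∃ u v, H.Adj u v) :
    ∃ a : ℝ, 0 < a ∧ ∃ T : ∀ N : ℕ, SimpleGraph (V × Fin (N + 1)), ∀ N : ℕ,
      a * ((N + 1 : ℕ) : ℝ) ^ (-fractionalMatchingNumber H) ≤ homDensity H (T N) ∧
      homDensity (SimpleGraph.completeGraph (Fin 2)) (T N) ≤ 4 * ((N + 1 : ℕ) : ℝ) ^ (-1 : ℝ) := by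
  obtain ⟨y, hy0, hy1, hyH, hyν⟩ := exists_fractional_vertexCover H h
  have : Nonempty V := ⟨h.choose⟩
  have hV : (0 : ℝ) < Fintype.card V := by exact_mod_cast Fintype.card_pos
  refine ⟨((Fintype.card V : ℝ) ^ Fintype.card V)⁻¹, by positivity,
    fun N => paddedBlowup H (fun v => ⌈((N + 1 : ℕ) : ℝ) ^ (1 - y v)⌉₊) (N + 1), fun N => ⟨?_, ?_⟩⟩
  · refine le_homDensity_paddedBlowup H N.succ_pos (fun v => Nat.ceil_le.2 ?_)
      (fun v => Nat.le_ceil _) hyν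
    refine (Real.rpow_le_rpow_of_exponent_le (by simp) ?_).trans_eq (Real.rpow_one _)
    linarith [hy0 v]
  · set M : ℝ := ((N + 1 : ℕ) : ℝ) with hM
    have hM1 : 1 ≤ M := by simp [hM]
    have hM0 : 0 < M := by linarith
    -- Rounding up costs at most a factor two because `y v ≤ 1` makes the power at least one; two
    -- endpoints account for the constant 4.
    have hs : ∀ v, (⌈M ^ (1 - y v)⌉₊ : ℝ) ≤ 2 * M ^ (1 - y v) := fun v => by
      have h1 : 1 ≤ M ^ (1 - y v) := Real.one_le_rpow hM1 (by linarith [hy1 v])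
      have h2 := (Nat.ceil_lt_add_one (zero_le_one.trans h1)).le
      linarith
    have hB : ∀ u v, H.Adj u v → (⌈M ^ (1 - y u)⌉₊ : ℝ) * ⌈M ^ (1 - y v)⌉₊ ≤ 4 * M :=
      fun u v huv =>
        calc (⌈M ^ (1 - y u)⌉₊ : ℝ) * ⌈M ^ (1 - y v)⌉₊
            ≤ (2 * M ^ (1 - y u)) * (2 * M ^ (1 - y v)) := by
              gcongr
              exacts [hs u, hs v]
          _ = 4 * M ^ (2 - (y u + y v)) := by
              rw [show 2 - (y u + y v) = (1 - y u) + (1 - y v) by ring, Real.rpow_add hM0]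
              ring
          _ ≤ 4 * M ^ (1 : ℝ) := by
              gcongr
              linarith [hyH u v huv]
          _ = 4 * M := by rw [Real.rpow_one]
    have key := card_edge_hom_paddedBlowup_le H (N := N + 1) hB (by positivity)
    rw [homDensity, Fintype.card_prod, Fintype.card_fin, Fintype.card_fin, Nat.cast_mul, ← hM,
      div_le_iff₀ (by positivity), Real.rpow_neg_one]
    refine key.trans (le_of_eq ?_)
    field_simp

/-! ### Fractional matchings bound densities by the edge density -/

open Classical in
theorem homDensity_le_rpow_sum_of_isFractionalMatching {V W : Type*} [Fintype V] [Fintype W]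
    [Nonempty W] {H : SimpleGraph V} {w : Sym2 V → ℝ} (hw : IsFractionalMatching H w)
    (T : SimpleGraph W) :
    homDensity H T ≤
      homDensity (SimpleGraph.completeGraph (Fin 2)) T ^ ∑ e ∈ H.edgeFinset, w e := by
  have hadj : ∀ e : H.edgeFinset, H.Adj e.1.out.1 e.1.out.2 := fun e => by
    have := SimpleGraph.mem_edgeFinset.1 e.2
    rwa [← Quot.out_eq e.1] at this
  let φ : H.edgeFinset → (SimpleGraph.completeGraph (Fin 2) →g H) := fun e =>
    { toFun := ![e.1.out.1, e.1.out.2]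
      map_rel' := fun {i j} hij => by
        fin_cases i <;> fin_cases j <;> simp [(hadj e), (hadj e).symm] at hij ⊢ }
  have hφ : ∀ e v, v ∈ Set.range (φ e) ↔ v ∈ e.1 := fun e v => by
    have : e.1 = s(e.1.out.1, e.1.out.2) := (Quot.out_eq e.1).symm
    conv_rhs => rw [this]
    simp [φ, or_comm]
  have key := homDensity_le_rpow_sum (w := fun e : H.edgeFinset => w e.1) φ
    (fun e i j hij => by
      have := (hadj e).ne
      fin_cases i <;> fin_cases j <;> simp_all [φ])
    (fun e => hw.1 e.1 e.2)
    (fun v => by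
      simp only [hφ]
      rw [sum_coe_sort H.edgeFinset (fun e => if v ∈ e then w e else 0), ← sum_filter]
      exact hw.2 v) T
  rwa [sum_coe_sort H.edgeFinset w] at key

theorem homDensity_le_rpow_fractionalMatchingNumber {V W : Type*} [Fintype V] [Fintype W]
    [Nonempty W] (H : SimpleGraph V) (h : ∃ u v, H.Adj u v)
    (T : SimpleGraph W) : homDensity H T ≤
      homDensity (SimpleGraph.completeGraph (Fin 2)) T ^ fractionalMatchingNumber H := by
  classical
  set p := homDensity (SimpleGraph.completeGraph (Fin 2)) T
  have hp : 0 ≤ p := homDensity_nonneg _ _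
  set S := {s : ℝ | ∃ w : Sym2 V → ℝ, IsFractionalMatching H w ∧
    s = ∑ e ∈ H.edgeFinset, w e} with hS
  have hle : ∀ s ∈ S, homDensity H T ≤ p ^ s := by
    rintro s ⟨w, hw, rfl⟩
    exact homDensity_le_rpow_sum_of_isFractionalMatching hw T
  have hν : 0 < sSup S := one_pos.trans_le (one_le_fractionalMatchingNumber h)
  have hne : S.Nonempty := ⟨0, 0, ⟨by simp, by simp⟩, by simp⟩
  -- The bound for each matching passes to the supremum by continuity of `s ↦ p ^ s`, which needs `p
  -- ≠ 0`; for `p = 0` one matching of positive weight is enough.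
  rcases hp.eq_or_lt with hp0 | hp0
  · obtain ⟨s, hs, hs0⟩ := exists_lt_of_lt_csSup hne hν
    have := hle s hs
    rw [← hp0, Real.zero_rpow hs0.ne'] at this
    exact this.trans (Real.rpow_nonneg hp _)
  · have hcl : IsClosed {s : ℝ | homDensity H T ≤ p ^ s} :=
      isClosed_le continuous_const (Real.continuous_const_rpow hp0.ne')
    exact hcl.closure_subset_iff.2 hle (csSup_mem_closure hne
      ⟨Fintype.card V, by rintro _ ⟨w, hw, rfl⟩; exact hw.sum_le_card⟩)

end DominationExponent

/-! ### The four cases -/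

namespace DominationExponent

open Finset

theorem le_rpow_of_le_rpow_inv {s t r : ℝ} (hs : 0 ≤ s) (ht : 0 ≤ t) (hr : 0 < r)
    (h : s ≤ t ^ r) : s ^ r⁻¹ ≤ t := by
  rw [← Real.rpow_rpow_inv ht hr.ne']
  exact Real.rpow_le_rpow hs h (inv_nonneg.2 hr.le)

/-- With `a = v(H₁)` and `b = v(H₂)`, a vertex lies in `(b-1).choose (a-1)` of the `a`-sets.
Weighting each chosen copy by the inverse of this number gives a packing of total weight `b / a`. -/
theorem homDensity_le_rpow_of_forall_isContained_induce {V₁ V₂ W : Type*} [Fintype V₁] [Fintype V₂]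
    [Fintype W] [Nonempty W] [Nonempty V₁] {H₁ : SimpleGraph V₁} {H₂ : SimpleGraph V₂}
    (hcard : Fintype.card V₁ ≤ Fintype.card V₂)
    (h : ∀ S : Finset V₂, S.card = Fintype.card V₁ → H₁.IsContained (H₂.induce (S : Set V₂)))
    (T : SimpleGraph W) :
    homDensity H₂ T ≤ homDensity H₁ T ^ ((Fintype.card V₂ : ℝ) / Fintype.card V₁) := by
  classical
  set a := Fintype.card V₁ with ha
  set b := Fintype.card V₂ with hb
  have ha0 : 0 < a := Fintype.card_pos
  let J := powersetCard a (univ : Finset V₂)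
  have hJ : ∀ S : J, S.1.card = a := fun S => (mem_powersetCard.1 S.2).2
  let φ : ∀ S : J, SimpleGraph.Copy H₁ (H₂.induce (S.1 : Set V₂)) := fun S => (h S.1 (hJ S)).some
  let e : ∀ S : J, SimpleGraph.Copy H₁ H₂ := fun S =>
    (SimpleGraph.Copy.induce H₂ (S.1 : Set V₂)).comp (φ S)
  have he : ∀ (S : J) v, v ∈ Set.range (e S) → v ∈ S.1 := by
    rintro S _ ⟨u, rfl⟩
    exact (φ S u).2
  have hc : 0 < (b - 1).choose (a - 1) := Nat.choose_pos (by omega)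
  have hmul : b * (b - 1).choose (a - 1) = b.choose a * a := by
    have := Nat.add_one_mul_choose_eq (b - 1) (a - 1)
    rwa [Nat.sub_add_cancel (by omega), Nat.sub_add_cancel ha0] at this
  have key := homDensity_le_rpow_sum (fun S => (e S).toHom) (fun S => (e S).injective)
    (w := fun _ => (((b - 1).choose (a - 1) : ℕ) : ℝ)⁻¹) (fun _ => by positivity)
    (fun v => by
      rw [← sum_filter, sum_const, nsmul_eq_mul, ← div_eq_mul_inv,
        div_le_one (by exact_mod_cast hc)]
      norm_cast
      have hle : #{S : J | v ∈ Set.range (e S).toHom} ≤ #{S ∈ J | v ∈ S} := by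
        refine card_le_card_of_injOn (fun S => S.1) (fun S hS => ?_)
          (Subtype.val_injective.injOn)
        exact mem_coe.2 (mem_filter.2 ⟨S.2, he S v (mem_filter.1 hS).2⟩)
      refine hle.trans ?_
      have hle2 : #{S ∈ J | v ∈ S} ≤ #(powersetCard (a - 1) (univ.erase v)) := by
        refine card_le_card_of_injOn (fun S => S.erase v) (fun S hS => ?_) fun S hS S' hS' hSS => ?_
        · obtain ⟨hS1, hS2⟩ := mem_filter.1 hS
          exact mem_coe.2 (mem_powersetCard.2 ⟨erase_subset_erase _ (subset_univ _), by
            rw [card_erase_of_mem hS2, (mem_powersetCard.1 hS1).2]⟩)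
        · rw [← insert_erase (mem_filter.1 hS).2, ← insert_erase (mem_filter.1 hS').2]
          exact congrArg (insert v) hSS
      refine hle2.trans_eq ?_
      rw [card_powersetCard, card_erase_of_mem (mem_univ v), card_univ]) T
  refine key.trans_eq ?_
  congr 1
  rw [sum_const, card_univ, Fintype.card_coe, card_powersetCard, card_univ, ← hb, nsmul_eq_mul,
    ← div_eq_mul_inv, div_eq_div_iff (by exact_mod_cast hc.ne') (by exact_mod_cast ha0.ne')]
  exact_mod_cast hmul.symm

theorem hasDominationExponent_of_forall_isContained_induce {V₁ V₂ : Type*} [Fintype V₁]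
    [Fintype V₂] [Nonempty V₁] {H₁ : SimpleGraph V₁} {H₂ : SimpleGraph V₂}
    (hH₁ : ∀ v, ∃ w, H₁.Adj v w) (hcard : Fintype.card V₁ ≤ Fintype.card V₂)
    (h : ∀ S : Finset V₂, S.card = Fintype.card V₁ → H₁.IsContained (H₂.induce (S : Set V₂))) :
    HasDominationExponent H₁ H₂ ((Fintype.card V₁ : ℝ) / Fintype.card V₂) := by
  have hV₁ : 0 < Fintype.card V₁ := Fintype.card_pos
  have : Nonempty V₂ := Fintype.card_pos_iff.1 (hV₁.trans_le hcard)
  have hV₂ : 0 < Fintype.card V₂ := Fintype.card_pos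
  refine ⟨fun W _ _ T => ?_, fun c hc => div_card_le_of_mem_dominatingExponents hH₁ hc⟩
  rw [← inv_div]
  exact le_rpow_of_le_rpow_inv (homDensity_nonneg _ _) (homDensity_nonneg _ _) (by positivity)
    (homDensity_le_rpow_of_forall_isContained_induce hcard h T)

theorem hasDominationExponent_path_two {V : Type*} [Fintype V] [Nonempty V] {H : SimpleGraph V}
    (hH : IsCoveredByLongPaths H) :
    HasDominationExponent (path 2) H (3 / (Fintype.card V : ℝ)) := by
  have hV : 0 < Fintype.card V := Fintype.card_pos
  refine ⟨fun W _ _ T => ?_, fun c hc => ?_⟩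
  · rw [← inv_div]
    exact le_rpow_of_le_rpow_inv (homDensity_nonneg _ _) (homDensity_nonneg _ _) (by positivity)
      (homDensity_le_of_isCoveredByLongPaths hH T)
  · have hP : ∀ u : Fin 3, ∃ v, (path 2).Adj u v := fun u => by
      simp only [SimpleGraph.pathGraph_adj]
      fin_cases u
      exacts [⟨1, by simp⟩, ⟨2, by simp⟩, ⟨1, by simp⟩]
    simpa using div_card_le_of_mem_dominatingExponents hP hc

theorem hasDominationExponent_edge {V : Type*} [Fintype V] {H : SimpleGraph V}
    (h : ∃ u v, H.Adj u v) :
    HasDominationExponent (SimpleGraph.completeGraph (Fin 2)) H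
      (fractionalMatchingNumber H)⁻¹ := by
  have hν : 0 < fractionalMatchingNumber H := one_pos.trans_le (one_le_fractionalMatchingNumber h)
  refine ⟨fun W _ _ T => ?_, fun c hc => ?_⟩
  · exact le_rpow_of_le_rpow_inv (homDensity_nonneg _ _) (homDensity_nonneg _ _) hν
      (homDensity_le_rpow_fractionalMatchingNumber H h T)
  · obtain ⟨a, ha, T, hT⟩ := exists_sparse_targets H h
    have : Nonempty V := ⟨h.choose⟩
    rw [← one_div]
    exact div_le_of_mem_dominatingExponents one_pos hν ha (fun N => V × Fin (N + 1)) T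
      (fun N => (hT N).1) (fun N => (hT N).2) hc

theorem hasDominationExponent_one_of_isContained {V₁ V₂ : Type*} [Fintype V₁] [Fintype V₂]
    {H₁ : SimpleGraph V₁} {H₂ : SimpleGraph V₂} (h : ∃ u v, H₁.Adj u v)
    (hsub : H₁.IsContained H₂)
    (hν : fractionalMatchingNumber H₁ = fractionalMatchingNumber H₂) :
    HasDominationExponent H₁ H₂ 1 := by
  refine ⟨fun W _ _ T => ?_, fun c hc => ?_⟩
  · rw [Real.rpow_one]
    exact homDensity_le_of_isContained hsub T
  · have h₂ : ∃ u v, H₂.Adj u v := by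
      obtain ⟨u, v, huv⟩ := h
      obtain ⟨φ⟩ := hsub
      exact ⟨φ u, φ v, φ.toHom.map_adj huv⟩
    obtain ⟨a, ha, T, hT⟩ := exists_sparse_targets H₂ h₂
    have : Nonempty V₂ := ⟨h₂.choose⟩
    set ν := fractionalMatchingNumber H₂
    have hν0 : 0 < ν := one_pos.trans_le (one_le_fractionalMatchingNumber h₂)
    rw [← div_self hν0.ne']
    refine div_le_of_mem_dominatingExponents (b := 4 ^ ν) hν0 hν0 ha
      (fun N => V₂ × Fin (N + 1)) T (fun N => (hT N).1) (fun N => ?_) hc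
    -- On the targets built for `H₂`, the edge density raised to `ν*(H₁) = ν*(H₂)` bounds `t(H₁,
    -- T)`, so both densities decay with the same exponent.
    calc homDensity H₁ (T N)
        ≤ homDensity (SimpleGraph.completeGraph (Fin 2)) (T N) ^ ν := by
          rw [← hν]
          exact homDensity_le_rpow_fractionalMatchingNumber H₁ h (T N)
      _ ≤ (4 * ((N + 1 : ℕ) : ℝ) ^ (-1 : ℝ)) ^ ν :=
          Real.rpow_le_rpow (homDensity_nonneg _ _) (hT N).2 hν0.le
      _ = 4 ^ ν * ((N + 1 : ℕ) : ℝ) ^ (-ν) := by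
          rw [Real.mul_rpow (by norm_num) (by positivity), ← Real.rpow_mul (by positivity),
            neg_one_mul]

end DominationExponent

theorem mainTheorem10 :
    -- (1)
    (∀ {V₁ V₂ : Type*} [Fintype V₁] [Fintype V₂] [Nonempty V₁]
        (H₁ : SimpleGraph V₁) (H₂ : SimpleGraph V₂),
        (∀ v, ∃ w, H₁.Adj v w) →
        Fintype.card V₁ ≤ Fintype.card V₂ →
        (∀ S : Finset V₂, S.card = Fintype.card V₁ →
          H₁.IsContained (H₂.induce (S : Set V₂))) →
        DominationExponent.HasDominationExponent H₁ H₂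
          ((Fintype.card V₁ : ℝ) / (Fintype.card V₂ : ℝ))) ∧
    -- (2)
    (∀ {V : Type*} [Fintype V] [Nonempty V] (H : SimpleGraph V),
        DominationExponent.IsCoveredByLongPaths H →
        DominationExponent.HasDominationExponent (DominationExponent.path 2) H
          (3 / (Fintype.card V : ℝ))) ∧
    -- (3)
    (∀ {V : Type*} [Fintype V] (H : SimpleGraph V),
        (∃ u v, H.Adj u v) →
        DominationExponent.HasDominationExponent (SimpleGraph.completeGraph (Fin 2)) H
          (DominationExponent.fractionalMatchingNumber H)⁻¹) ∧
    -- (4)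
    (∀ {V₁ V₂ : Type*} [Fintype V₁] [Fintype V₂]
        (H₁ : SimpleGraph V₁) (H₂ : SimpleGraph V₂),
        (∃ u v, H₁.Adj u v) →
        H₁.IsContained H₂ →
        DominationExponent.fractionalMatchingNumber H₁ =
          DominationExponent.fractionalMatchingNumber H₂ →
        DominationExponent.HasDominationExponent H₁ H₂ 1) := by
  refine ⟨?_, ?_, ?_, ?_⟩
  · intro V₁ V₂ _ _ _ H₁ H₂ hH₁ hcard h
    exact DominationExponent.hasDominationExponent_of_forall_isContained_induce hH₁ hcard h
  · intro V _ _ H hH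
    exact DominationExponent.hasDominationExponent_path_two hH
  · intro V _ H h
    exact DominationExponent.hasDominationExponent_edge h
  · intro V₁ V₂ _ _ H₁ H₂ h hsub hν
    exact DominationExponent.hasDominationExponent_one_of_isContained h hsub hν
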